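/- Let $X$ be a locally compact Hausdorff space, with open sets $\mathscr O(X)$, closed sets $\mathscr C(X)$ and compact sets $\mathscr K(X)$. A deficient topological measure (DTM) on $X$ is a map $\nu:\mathscr O(X)\cup\mathscr C(X)\to[0,\infty]$, not identically $\infty$, such that $\nu(C\sqcup K)=\nu(C)+\nu(K)$ for disjoint $C,K\in\mathscr K(X)$, $\nu(U)=\sup\{\nu(C):C\subseteq U,\ C\in\mathscr K(X)\}$ for $U\in\mathscr O(X)$, and $\nu(F)=\inf\{\nu(U):F\subseteq U,\ U\in\mathscr O(X)\}$ for $F\in\mathscr C(X)$. It is a topological measure (TM) if moreover $\nu(A\sqcup B)=\nu(A)+\nu(B)$ whenever $A,B$ are disjoint and $A,B,A\sqcup B\in\mathscr K(X)\cup\mathscr O(X)$. It is finite if $\nu(X)<\infty$, simple if it only assumes the values $0$ and $1$, and proper if the only Radon measure $m$ with $m\le\nu$ on $\mathscr O(X)\cup\mathscr C(X)$ is $m=0$. A Radon measure is a Borel measure that is finite on compact sets, outer regular on Borel sets, and inner regular (by compact sets) on open sets. Let $\mathbf{DTM}(X)$ and $\mathbf{TM}(X)$ be the sets of finite DTMs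 and finite TMs. Let $\mathbf M(X)$ be the set of restrictions to $\mathscr O(X)\cup\mathscr C(X)$ of finite Borel measures that are inner regular (by compact sets) on open sets and outer regular on Borel sets. Then $\mathbf M(X)\subseteq\mathbf{TM}(X)\subseteq\mathbf{DTM}(X)$. Let $p\mathbf{DTM}(X)$ and $p\mathbf{TM}(X)$ be the sets of proper elements of $\mathbf{DTM}(X)$ and $\mathbf{TM}(X)$. Point-masses are the maps $\delta_x$, $x\in X$, with $\delta_x(A)=1$ if $x\in A$ and $\delta_x(A)=0$ otherwise. For $\mu\in\mathbf{DTM}(X)$ and a nonnegative $f\in C_0(X)$ put $\int f\,d\mu=\int_0^{\|f\|}\mu(f^{-1}((t,\infty)))\,dt$. Equip $\mathbf{DTM}(X)$ with the weak topology, the coarsest topology making $\mu\mapsto\int f\,d\mu$ continuous for every nonnegative $f\in C_0(X)$. A set $Y$ is called dense in $Z$ if $Z\subseteq\overline Y$. 1. For deficient topological measures consider the conditions - (A) the proper simple DTMs that are not TMs are dense in the set of all point-masses; - (B) $p\mathbf{DTM}(X)\setminus\mathbf{TM}(X)$ is dense in $\mathbf M(X)$; - (C) $\mathbf{DTM}(X)\setminus\mathbf{TM}(X)\neq\emptyset$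 and $p\mathbf{DTM}(X)\setminus\mathbf{TM}(X)$ is dense in $\mathbf{DTM}(X)\setminus\mathbf{TM}(X)$; - (D) $p\mathbf{DTM}(X)$ is dense in $\mathbf{DTM}(X)$; - (E) $p\mathbf{DTM}(X)$ is dense in $\mathbf M(X)$. Then (B) $\Leftrightarrow$ (C) $\Rightarrow$ (D) $\Leftrightarrow$ (E), and if $X\ne\emptyset$ then (A) $\Rightarrow$ (B). 2. For topological measures: if the proper simple TMs are dense in the set of all point-masses, then $p\mathbf{TM}(X)$ is dense in $\mathbf M(X)$. Next, $p\mathbf{TM}(X)$ is dense in $\mathbf M(X)$ if and only if $p\mathbf{TM}(X)$ is dense in $\mathbf{TM}(X)$, and in that case $p\mathbf{DTM}(X)$ is dense in $\mathbf{DTM}(X)$. -/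

import Mathlib

open MeasureTheory Set
open scoped ENNReal Topology ZeroAtInfty

/-- The open and the closed subsets of `X`: the common domain of (deficient) topological
measures. In a Hausdorff space it contains every compact set. -/
def OCSet (X : Type*) [TopologicalSpace X] : Type _ :=
  {A : Set X // IsOpen A ∨ IsClosed A}

/-- A deficient topological measure. The field `exists_ne_top` is the usual convention that maps
into the extended reals are not identically infinite. -/
structure IsDTM {X : Type*} [TopologicalSpace X] (ν : OCSet X → ℝ≥0∞) : Prop where
  exists_ne_top : ∃ A, ν A ≠ ∞
  add_compact : ∀ C K D : OCSet X, IsCompact C.1 → IsCompact K.1 → Disjoint C.1 K.1 →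
    D.1 = C.1 ∪ K.1 → ν D = ν C + ν K
  inner_regular : ∀ U : OCSet X, IsOpen U.1 →
    ν U = sSup (ν '' {C | IsCompact C.1 ∧ C.1 ⊆ U.1})
  outer_regular : ∀ F : OCSet X, IsClosed F.1 →
    ν F = sInf (ν '' {U | IsOpen U.1 ∧ F.1 ⊆ U.1})

/-- A topological measure. -/
structure IsTM {X : Type*} [TopologicalSpace X] (μ : OCSet X → ℝ≥0∞) : Prop where
  exists_ne_top : ∃ A, μ A ≠ ∞
  add : ∀ A B D : OCSet X, (IsCompact A.1 ∨ IsOpen A.1) → (IsCompact B.1 ∨ IsOpen B.1) →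
    (IsCompact D.1 ∨ IsOpen D.1) → Disjoint A.1 B.1 → D.1 = A.1 ∪ B.1 → μ D = μ A + μ B
  inner_regular : ∀ U : OCSet X, IsOpen U.1 →
    μ U = sSup (μ '' {K | IsCompact K.1 ∧ K.1 ⊆ U.1})
  outer_regular : ∀ F : OCSet X, IsClosed F.1 →
    μ F = sInf (μ '' {U | IsOpen U.1 ∧ F.1 ⊆ U.1})

/-- A set function is simple if it only assumes the values `0` and `1`. -/
def IsSimpleSetFun {X : Type*} [TopologicalSpace X] (ν : OCSet X → ℝ≥0∞) : Prop :=
  ∀ A, ν A = 0 ∨ ν A = 1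

/-- `ν` is proper if the only Radon measure `m ≤ ν` (on open and closed sets) is `0`.
`Measure.Regular` says: finite on compact sets, outer regular on Borel sets, and inner
regular with respect to compact sets on open sets. -/
def IsProperSetFun {X : Type*} [TopologicalSpace X] [MeasurableSpace X] [BorelSpace X]
    (ν : OCSet X → ℝ≥0∞) : Prop :=
  ∀ m : Measure X, m.Regular → (∀ A : OCSet X, m A.1 ≤ ν A) → m = 0

/-- The space `DTM(X)` of finite deficient topological measures on `X`. -/
def FinDTM (X : Type*) [TopologicalSpace X] : Type _ :=
  {ν : OCSet X → ℝ≥0∞ // IsDTM ν ∧ ν ⟨univ, Or.inl isOpen_univ⟩ < ∞}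

/-- The cone of nonnegative continuous functions vanishing at infinity. -/
def C0Plus (X : Type*) [TopologicalSpace X] : Type _ :=
  {f : C₀(X, ℝ) // ∀ x, 0 ≤ f x}

/-- The open superlevel set `f⁻¹((t, ∞))`. -/
def superlevel {X : Type*} [TopologicalSpace X] (f : C₀(X, ℝ)) (t : ℝ) : OCSet X :=
  ⟨f ⁻¹' Ioi t, Or.inl (isOpen_Ioi.preimage f.continuous)⟩

/-- The quasi-integral `∫ f dμ = ∫₀ᵇ μ(f⁻¹((t, ∞))) dt` of a function `f ≥ 0` in `C₀(X)`, where
`f(X) ⊆ [0, b]`; here `b = ‖f‖`. The integrand is bounded and nonincreasing. -/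
noncomputable def quasiIntegral {X : Type*} [TopologicalSpace X] (μ : FinDTM X)
    (f : C0Plus X) : ℝ :=
  ∫ t in (0 : ℝ)..‖f.1‖, (μ.1 (superlevel f.1 t)).toReal

/-- The weak topology on `DTM(X)`: the coarsest one for which all the maps `μ ↦ ∫ f dμ`, with
`f ≥ 0` in `C₀(X)`, are continuous. -/
noncomputable instance FinDTM.weakTopology (X : Type*) [TopologicalSpace X] :
    TopologicalSpace (FinDTM X) :=
  TopologicalSpace.induced (fun (μ : FinDTM X) (f : C0Plus X) => quasiIntegral μ f)
    Pi.topologicalSpace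

/-- `Y` is dense in `Z` if `Z ⊆ closure Y`; the set `Y` need not be contained in `Z`. -/
def DenseIn {T : Type*} [TopologicalSpace T] (Y Z : Set T) : Prop :=
  Z ⊆ closure Y

/-- `TM(X)`: the finite topological measures. -/
def finTM (X : Type*) [TopologicalSpace X] : Set (FinDTM X) :=
  {μ | IsTM μ.1}

/-- `M(X)`: the restrictions to open and closed sets of the finite Borel measures that are inner
regular (by compact sets) on open sets and outer regular on Borel sets. -/
def finM (X : Type*) [TopologicalSpace X] [MeasurableSpace X] [BorelSpace X] :
    Set (FinDTM X) :=
  {μ | ∃ m : Measure X, m.OuterRegular ∧ m.InnerRegularWRT IsCompact IsOpen ∧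
    ∀ A : OCSet X, μ.1 A = m A.1}

/-- `pDTM(X)`: the proper finite deficient topological measures. -/
def properDTM (X : Type*) [TopologicalSpace X] [MeasurableSpace X] [BorelSpace X] :
    Set (FinDTM X) :=
  {μ | IsProperSetFun μ.1}

/-- `pTM(X)`: the proper finite topological measures. -/
def properTM (X : Type*) [TopologicalSpace X] [MeasurableSpace X] [BorelSpace X] :
    Set (FinDTM X) :=
  properDTM X ∩ finTM X

/-- The simple (hence finite) deficient topological measures. -/
def simpleDTM (X : Type*) [TopologicalSpace X] : Set (FinDTM X) :=
  {μ | IsSimpleSetFun μ.1}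

/-- The point-masses `δ_x`, with `δ_x(A) = 1` if `x ∈ A` and `δ_x(A) = 0` otherwise. -/
def pointMasses (X : Type*) [TopologicalSpace X] : Set (FinDTM X) :=
  {μ | ∃ x : X, ∀ A : OCSet X, μ.1 A = A.1.indicator 1 x}

/-! Everything rests on a splitting: each finite DTM `ν` is `μ + ρ` with `μ` a Radon measure and `ρ`
proper (`exists_eq_add_proper`). Here `μ` is the largest Radon measure below `ν`; on compact sets it
is the infimum of `∑ ν(Uᵢ)` over finite open covers, so `ν` is proper exactly when this infimum
vanishes on all compact sets. Sums of proper DTMs are proper (`add_mem_properDTM`), so if `μ` is a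
limit of proper DTMs `ν'`, then `ν` is the limit of the proper `ν' + ρ`. Thus density in the
measures spreads to all DTMs. The variants inside and outside `TM(X)` follow because a summand of a
TM is a TM.

Conversely, if `μ₀` is not a TM, then `μ + c • μ₀` is not a TM for `c > 0` and tends to `μ` as `c →
0`, whence (C) ⇒ (B).

For point-masses, only finitely many test functions `fᵢ` matter at a time. The vector `(∫ fᵢ dm)` is
the total mass times an average of the vectors `(fᵢ(x))`, and such an average lies in any closed
convex set containing them. -/

/-! ### Monotonicity and superadditivity. -/

section Basics

variable {X : Type*} [TopologicalSpace X]

/-- An open set as an element of `OCSet X`. -/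
def OCSet.ofOpen (U : Set X) (hU : IsOpen U) : OCSet X := ⟨U, Or.inl hU⟩

/-- A compact set as an element of `OCSet X`. -/
def OCSet.ofCompact [T2Space X] (K : Set X) (hK : IsCompact K) : OCSet X :=
  ⟨K, Or.inr hK.isClosed⟩

/-- The whole space as an element of `OCSet X`. -/
def OCSet.univ (X : Type*) [TopologicalSpace X] : OCSet X := ⟨Set.univ, Or.inl isOpen_univ⟩

theorem OCSet.measurableSet [MeasurableSpace X] [BorelSpace X] (A : OCSet X) :
    MeasurableSet A.1 :=
  A.2.elim (fun h => h.measurableSet) (fun h => h.measurableSet)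

namespace IsDTM

variable {ν : OCSet X → ℝ≥0∞} (h : IsDTM ν)
include h

theorem mono_compact_open {C U : OCSet X} (hC : IsCompact C.1) (hU : IsOpen U.1)
    (hCU : C.1 ⊆ U.1) : ν C ≤ ν U := by
  rw [h.inner_regular U hU]
  exact le_sSup ⟨C, ⟨hC, hCU⟩, rfl⟩

theorem mono_closed_open {F U : OCSet X} (hF : IsClosed F.1) (hU : IsOpen U.1)
    (hFU : F.1 ⊆ U.1) : ν F ≤ ν U := by
  rw [h.outer_regular F hF]
  exact sInf_le ⟨U, ⟨hU, hFU⟩, rfl⟩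

theorem mono_open {U V : OCSet X} (hU : IsOpen U.1) (hV : IsOpen V.1) (hUV : U.1 ⊆ V.1) :
    ν U ≤ ν V := by
  rw [h.inner_regular U hU]
  refine sSup_le ?_
  rintro _ ⟨C, ⟨hC, hCU⟩, rfl⟩
  exact h.mono_compact_open hC hV (hCU.trans hUV)

theorem mono {A B : OCSet X} (hAB : A.1 ⊆ B.1) : ν A ≤ ν B := by
  rcases B.2 with hB | hB
  · rcases A.2 with hA | hA
    · exact h.mono_open hA hB hAB
    · exact h.mono_closed_open hA hB hAB
  · rw [h.outer_regular B hB]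
    refine le_sInf ?_
    rintro _ ⟨U, ⟨hU, hBU⟩, rfl⟩
    rcases A.2 with hA | hA
    · exact h.mono_open hA hU (hAB.trans hBU)
    · exact h.mono_closed_open hA hU (hAB.trans hBU)

theorem le_univ (A : OCSet X) : ν A ≤ ν (OCSet.univ X) := h.mono (subset_univ _)

theorem exists_compact_le_add {U : OCSet X} (hU : IsCompact U.1 ∨ IsOpen U.1)
    (hfin : ν U ≠ ∞) {ε : ℝ≥0∞} (hε : ε ≠ 0) :
    ∃ C : OCSet X, IsCompact C.1 ∧ C.1 ⊆ U.1 ∧ ν U ≤ ν C + ε := by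
  rcases hU with hU | hU
  · exact ⟨U, hU, Subset.rfl, le_self_add⟩
  by_cases h0 : ν U = 0
  · exact ⟨⟨∅, Or.inl isOpen_empty⟩, isCompact_empty, empty_subset _, by simp [h0]⟩
  have hlt : ν U - ε < ν U := ENNReal.sub_lt_self hfin h0 hε
  rw [h.inner_regular U hU] at hlt
  obtain ⟨_, ⟨C, ⟨hC, hCU⟩, rfl⟩, hlt⟩ := lt_sSup_iff.1 hlt
  rw [← h.inner_regular U hU] at hlt
  exact ⟨C, hC, hCU, tsub_le_iff_right.1 hlt.le⟩

theorem exists_open_le_add {F : OCSet X} (hF : IsClosed F.1)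
    (hfin : ν F ≠ ∞) {ε : ℝ≥0∞} (hε : ε ≠ 0) :
    ∃ U : OCSet X, IsOpen U.1 ∧ F.1 ⊆ U.1 ∧ ν U ≤ ν F + ε := by
  have hlt : ν F < ν F + ε := ENNReal.lt_add_right hfin hε
  rw [h.outer_regular F hF] at hlt
  obtain ⟨_, ⟨U, ⟨hU, hFU⟩, rfl⟩, hlt⟩ := sInf_lt_iff.1 hlt
  rw [← h.outer_regular F hF] at hlt
  exact ⟨U, hU, hFU, hlt.le⟩

/-- The empty set is disjoint from itself, so its value equals its own double; finiteness then
forces `0`. -/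
theorem empty_eq_zero (hfin : ν (OCSet.univ X) ≠ ∞) (E : OCSet X) (hE : E.1 = ∅) : ν E = 0 := by
  have hc : IsCompact E.1 := hE ▸ isCompact_empty
  have h2 := h.add_compact E E E hc hc (by simp [hE]) (by simp)
  have hf : ν E ≠ ∞ := ne_top_of_le_ne_top hfin (h.le_univ E)
  exact ((ENNReal.add_right_inj hf).1 ((add_zero _).trans h2)).symm

/-- Superadditivity on disjoint sets that are compact or open. -/
theorem add_le [T2Space X] (hfin : ν (OCSet.univ X) ≠ ∞) {A B D : OCSet X}
    (hA : IsCompact A.1 ∨ IsOpen A.1) (hB : IsCompact B.1 ∨ IsOpen B.1)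
    (hAB : Disjoint A.1 B.1) (hD : A.1 ∪ B.1 ⊆ D.1) : ν A + ν B ≤ ν D := by
  have hf : ∀ A, ν A ≠ ∞ := fun A => ne_top_of_le_ne_top hfin (h.le_univ A)
  refine ENNReal.le_of_forall_pos_le_add fun ε hε _ => ?_
  have hε' : (ε / 2 : ℝ≥0∞) ≠ 0 := by simpa using hε.ne'
  obtain ⟨C, hC, hCA, hC'⟩ := h.exists_compact_le_add hA (hf A) hε'
  obtain ⟨K, hK, hKB, hK'⟩ := h.exists_compact_le_add hB (hf B) hε'
  have hCK := h.add_compact C K (OCSet.ofCompact _ (hC.union hK)) hC hK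
    (hAB.mono hCA hKB) rfl
  calc ν A + ν B ≤ (ν C + ε / 2) + (ν K + ε / 2) := add_le_add hC' hK'
    _ = (ν C + ν K) + ε := by rw [add_add_add_comm, ENNReal.add_halves]
    _ ≤ ν D + ε := by
      rw [← hCK]
      gcongr
      exact h.mono ((union_subset_union hCA hKB).trans hD)

/-- Superadditivity for a closed set and its complement in an open set. -/
theorem closed_add_sdiff_le [T2Space X] [LocallyCompactSpace X]
    (hfin : ν (OCSet.univ X) ≠ ∞) {F D U : OCSet X}
    (hF : IsClosed F.1) (hU : IsOpen U.1) (hFU : F.1 ⊆ U.1) (hD : D.1 = U.1 \ F.1) :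
    ν F + ν D ≤ ν U := by
  have hDo : IsOpen D.1 := hD ▸ hU.sdiff hF
  refine ENNReal.le_of_forall_pos_le_add fun ε hε _ => ?_
  obtain ⟨C, hC, hCD, hC'⟩ := h.exists_compact_le_add (Or.inr hDo)
    (ne_top_of_le_ne_top hfin (h.le_univ D)) (ε := ε) (by simpa using hε.ne')
  -- Removing a compact neighbourhood `L` of `C` leaves an open set that contains `F` and misses
  -- `C`, which reduces the claim to `add_le`.
  obtain ⟨L, hL, hCL, hLD⟩ := exists_compact_between hC hDo hCD
  rw [hD] at hLD
  have hW : IsOpen (U.1 \ L) := hU.sdiff hL.isClosed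
  have hFW : F.1 ⊆ U.1 \ L := fun x hx => ⟨hFU hx, fun hxL => (hLD hxL).2 hx⟩
  calc ν F + ν D ≤ ν (OCSet.ofOpen _ hW) + (ν C + ε) :=
        add_le_add (h.mono_closed_open hF hW hFW) hC'
    _ = (ν (OCSet.ofOpen _ hW) + ν C) + ε := (add_assoc _ _ _).symm
    _ ≤ ν U + ε := by
      gcongr
      refine h.add_le hfin (Or.inr hW) (Or.inl hC) ?_ ?_
      · exact disjoint_left.2 fun x hx hxC => hx.2 (interior_subset (hCL hxC))
      · refine union_subset sdiff_subset fun x hx => ?_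
        have := hCD hx
        rw [hD] at this
        exact this.1

/-- Superadditivity for a finite disjoint family of compact sets. -/
theorem sum_compact_le [T2Space X] (hfin : ν (OCSet.univ X) ≠ ∞) {ι : Type*}
    (s : Finset ι) (C : ι → OCSet X) (hC : ∀ i, IsCompact (C i).1)
    (hd : Pairwise (Function.onFun Disjoint fun i => (C i).1)) {U : OCSet X}
    (hCU : ∀ i ∈ s, (C i).1 ⊆ U.1) : ∑ i ∈ s, ν (C i) ≤ ν U := by
  classical
  have key : ∀ s : Finset ι, ∃ K : OCSet X, K.1 = ⋃ i ∈ s, (C i).1 ∧ IsCompact K.1 ∧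
      ∑ i ∈ s, ν (C i) = ν K := by
    intro s
    induction s using Finset.induction_on with
    | empty =>
      exact ⟨⟨∅, Or.inl isOpen_empty⟩, by simp, isCompact_empty,
        by simp [h.empty_eq_zero hfin ⟨∅, Or.inl isOpen_empty⟩ rfl]⟩
    | insert a s ha ih =>
      obtain ⟨K, hK, hKc, hsum⟩ := ih
      refine ⟨OCSet.ofCompact _ ((hC a).union hKc), ?_, (hC a).union hKc, ?_⟩
      · simp [OCSet.ofCompact, hK]
      · rw [Finset.sum_insert ha, hsum]
        refine (h.add_compact _ _ _ (hC a) hKc ?_ rfl).symm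
        rw [hK]
        refine disjoint_iUnion₂_right.2 fun i hi => hd ?_
        rintro rfl
        exact ha hi
  obtain ⟨K, hK, -, hsum⟩ := key s
  rw [hsum]
  exact h.mono (by rw [hK]; exact iUnion₂_subset hCU)

end IsDTM

/-- A criterion for a finite set function to be a deficient topological measure. -/
theorem IsDTM.of_forall_pos [T2Space X] {ν : OCSet X → ℝ≥0∞}
    (hfin : ∀ A, ν A ≠ ∞)
    (hmono : ∀ F U : OCSet X, IsClosed F.1 → IsOpen U.1 → F.1 ⊆ U.1 → ν F ≤ ν U)
    (hadd : ∀ C K D : OCSet X, IsCompact C.1 → IsCompact K.1 → Disjoint C.1 K.1 →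
      D.1 = C.1 ∪ K.1 → ν D = ν C + ν K)
    (hinner : ∀ U : OCSet X, IsOpen U.1 → ∀ ε : ℝ≥0∞, ε ≠ 0 →
      ∃ C : OCSet X, IsCompact C.1 ∧ C.1 ⊆ U.1 ∧ ν U ≤ ν C + ε)
    (houter : ∀ F : OCSet X, IsClosed F.1 → ∀ ε : ℝ≥0∞, ε ≠ 0 →
      ∃ U : OCSet X, IsOpen U.1 ∧ F.1 ⊆ U.1 ∧ ν U ≤ ν F + ε) : IsDTM ν where
  exists_ne_top := ⟨OCSet.univ X, hfin _⟩
  add_compact := hadd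
  inner_regular U hU := by
    refine le_antisymm (ENNReal.le_of_forall_pos_le_add fun ε hε _ => ?_) (sSup_le ?_)
    · obtain ⟨C, hC, hCU, hle⟩ := hinner U hU ε (by simpa using hε.ne')
      refine hle.trans ?_
      gcongr
      exact le_sSup ⟨C, ⟨hC, hCU⟩, rfl⟩
    · rintro _ ⟨C, ⟨hC, hCU⟩, rfl⟩
      exact hmono C U hC.isClosed hU hCU
  outer_regular F hF := by
    refine le_antisymm (le_sInf ?_) (ENNReal.le_of_forall_pos_le_add fun ε hε _ => ?_)
    · rintro _ ⟨U, ⟨hU, hFU⟩, rfl⟩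
      exact hmono F U hF hU hFU
    · obtain ⟨U, hU, hFU, hle⟩ := houter F hF ε (by simpa using hε.ne')
      exact le_trans (sInf_le ⟨U, ⟨hU, hFU⟩, rfl⟩) hle

theorem isTM_iff_isDTM_and_add {μ : OCSet X → ℝ≥0∞} :
    IsTM μ ↔ IsDTM μ ∧ ∀ A B D : OCSet X, (IsCompact A.1 ∨ IsOpen A.1) →
      (IsCompact B.1 ∨ IsOpen B.1) → (IsCompact D.1 ∨ IsOpen D.1) → Disjoint A.1 B.1 →
      D.1 = A.1 ∪ B.1 → μ D = μ A + μ B := by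
  refine ⟨fun h => ⟨⟨h.exists_ne_top, fun C K D hC hK hd hD => ?_, h.inner_regular,
    h.outer_regular⟩, h.add⟩, fun h => ⟨h.1.exists_ne_top, h.2, h.1.inner_regular,
    h.1.outer_regular⟩⟩
  exact h.add C K D (Or.inl hC) (Or.inl hK) (Or.inl (hD ▸ hC.union hK)) hd hD

end Basics

/-! ### The cone of finite DTMs. -/

namespace FinDTM

variable {X : Type*} [TopologicalSpace X]

theorem ne_top (μ : FinDTM X) (A : OCSet X) : μ.1 A ≠ ∞ :=
  ne_top_of_le_ne_top μ.2.2.ne (μ.2.1.le_univ A)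

variable [T2Space X]

noncomputable instance : Add (FinDTM X) where
  add μ ν := by
    refine ⟨fun A => μ.1 A + ν.1 A, IsDTM.of_forall_pos ?_ ?_ ?_ ?_ ?_, ?_⟩
    · exact fun A => ENNReal.add_ne_top.2 ⟨μ.ne_top A, ν.ne_top A⟩
    · exact fun F U _ _ h => add_le_add (μ.2.1.mono h) (ν.2.1.mono h)
    · intro C K D hC hK hd hD
      simp only [μ.2.1.add_compact C K D hC hK hd hD, ν.2.1.add_compact C K D hC hK hd hD]
      exact add_add_add_comm _ _ _ _
    · intro U hU ε hε
      have hε' : ε / 2 ≠ 0 := by simpa using hε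
      obtain ⟨C, hC, hCU, h1⟩ := μ.2.1.exists_compact_le_add (Or.inr hU) (μ.ne_top U) hε'
      obtain ⟨K, hK, hKU, h2⟩ := ν.2.1.exists_compact_le_add (Or.inr hU) (ν.ne_top U) hε'
      refine ⟨OCSet.ofCompact _ (hC.union hK), hC.union hK, union_subset hCU hKU, ?_⟩
      refine (add_le_add h1 h2).trans ?_
      rw [add_add_add_comm, ENNReal.add_halves]
      gcongr
      · exact μ.2.1.mono subset_union_left
      · exact ν.2.1.mono subset_union_right
    · intro F hF ε hε
      have hε' : ε / 2 ≠ 0 := by simpa using hε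
      obtain ⟨U, hU, hFU, h1⟩ := μ.2.1.exists_open_le_add hF (μ.ne_top F) hε'
      obtain ⟨V, hV, hFV, h2⟩ := ν.2.1.exists_open_le_add hF (ν.ne_top F) hε'
      refine ⟨OCSet.ofOpen _ (hU.inter hV), hU.inter hV, subset_inter hFU hFV, ?_⟩
      rw [← ENNReal.add_halves ε, add_add_add_comm]
      refine (add_le_add ?_ ?_).trans (add_le_add h1 h2)
      · exact μ.2.1.mono inter_subset_left
      · exact ν.2.1.mono inter_subset_right
    · exact ENNReal.add_lt_top.2 ⟨μ.2.2, ν.2.2⟩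

theorem add_apply (μ ν : FinDTM X) (A : OCSet X) : (μ + ν).1 A = μ.1 A + ν.1 A := rfl

noncomputable instance : SMul NNReal (FinDTM X) where
  smul c μ := by
    refine ⟨fun A => c * μ.1 A, IsDTM.of_forall_pos ?_ ?_ ?_ ?_ ?_, ?_⟩
    · exact fun A => ENNReal.mul_ne_top ENNReal.coe_ne_top (μ.ne_top A)
    · exact fun F U _ _ h => by gcongr; exact μ.2.1.mono h
    · intro C K D hC hK hd hD
      simp only [μ.2.1.add_compact C K D hC hK hd hD, mul_add]
    · intro U hU ε hε
      -- For `c = 0` the quotient `ε / c` is `∞`, still nonzero, and `c * (ε / c) = 0 ≤ ε`.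
      obtain ⟨C, hC, hCU, h1⟩ := μ.2.1.exists_compact_le_add (Or.inr hU) (μ.ne_top U)
        (ε := ε / c) (by simpa using hε)
      refine ⟨C, hC, hCU, ?_⟩
      calc (c : ℝ≥0∞) * μ.1 U ≤ c * (μ.1 C + ε / c) := by gcongr
        _ ≤ c * μ.1 C + ε := by rw [mul_add]; gcongr; exact ENNReal.mul_div_le
    · intro F hF ε hε
      obtain ⟨U, hU, hFU, h1⟩ := μ.2.1.exists_open_le_add hF (μ.ne_top F)
        (ε := ε / c) (by simpa using hε)
      refine ⟨U, hU, hFU, ?_⟩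
      calc (c : ℝ≥0∞) * μ.1 U ≤ c * (μ.1 F + ε / c) := by gcongr
        _ ≤ c * μ.1 F + ε := by rw [mul_add]; gcongr; exact ENNReal.mul_div_le
    · exact ENNReal.mul_lt_top ENNReal.coe_lt_top μ.2.2

theorem smul_apply (c : NNReal) (μ : FinDTM X) (A : OCSet X) : (c • μ).1 A = c * μ.1 A := rfl

theorem add_mem_finTM {μ ν : FinDTM X} (hμ : μ ∈ finTM X) (hν : ν ∈ finTM X) :
    μ + ν ∈ finTM X := by
  refine isTM_iff_isDTM_and_add.2 ⟨(μ + ν).2.1, fun A B D hA hB hD hd h => ?_⟩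
  simp only [add_apply, hμ.add A B D hA hB hD hd h, hν.add A B D hA hB hD hd h]
  exact add_add_add_comm _ _ _ _

/-- If a sum of finite deficient topological measures is a topological measure, then so is
each summand. -/
theorem mem_finTM_of_add_left {μ ν : FinDTM X} (h : μ + ν ∈ finTM X) : μ ∈ finTM X := by
  refine isTM_iff_isDTM_and_add.2 ⟨μ.2.1, fun A B D hA hB hD hd hAB => ?_⟩
  have h1 := h.add A B D hA hB hD hd hAB
  simp only [add_apply] at h1
  -- Both summands are superadditive, so equality for the sum forces equality for each.
  have h2 := μ.2.1.add_le μ.2.2.ne hA hB hd hAB.ge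
  have h3 := ν.2.1.add_le ν.2.2.ne hA hB hd hAB.ge
  refine le_antisymm ?_ h2
  rw [add_add_add_comm] at h1
  have h4 : μ.1 D + ν.1 D ≤ (μ.1 A + μ.1 B) + ν.1 D := by
    rw [h1]; gcongr
  exact (ENNReal.add_le_add_iff_right (ν.ne_top D)).1 h4

theorem smul_mem_finTM (c : NNReal) {μ : FinDTM X} (hμ : μ ∈ finTM X) : c • μ ∈ finTM X := by
  refine isTM_iff_isDTM_and_add.2 ⟨(c • μ).2.1, fun A B D hA hB hD hd h => ?_⟩
  simp only [smul_apply, hμ.add A B D hA hB hD hd h, mul_add]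

theorem smul_mem_finTM_iff {c : NNReal} (hc : c ≠ 0) {μ : FinDTM X} :
    c • μ ∈ finTM X ↔ μ ∈ finTM X := by
  refine ⟨fun h => ?_, smul_mem_finTM c⟩
  have : c⁻¹ • c • μ = μ := by
    refine Subtype.ext (funext fun A => ?_)
    simp only [smul_apply, ← mul_assoc, ← ENNReal.coe_mul, inv_mul_cancel₀ hc, ENNReal.coe_one,
      one_mul]
  exact this ▸ smul_mem_finTM c⁻¹ h

end FinDTM

/-! ### Finite open covers. -/

section Cover

open TopologicalSpace

variable {X : Type*} [TopologicalSpace X]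

/-- The infimum of `∑ ν(Uᵢ)` over the finite open covers `(Uᵢ)` of `A`. -/
noncomputable def coverInf (ν : OCSet X → ℝ≥0∞) (A : Set X) : ℝ≥0∞ :=
  ⨅ (n : ℕ) (U : Fin n → Opens X) (_ : A ⊆ ⋃ i, (U i : Set X)),
    ∑ i, ν (OCSet.ofOpen (U i) (U i).2)

theorem coverInf_le {ν : OCSet X → ℝ≥0∞} {A : Set X} {n : ℕ} (U : Fin n → Opens X)
    (h : A ⊆ ⋃ i, (U i : Set X)) : coverInf ν A ≤ ∑ i, ν (OCSet.ofOpen (U i) (U i).2) :=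
  iInf_le_of_le n (iInf₂_le U h)

theorem le_coverInf {ν : OCSet X → ℝ≥0∞} {A : Set X} {b : ℝ≥0∞}
    (h : ∀ (n : ℕ) (U : Fin n → Opens X), A ⊆ ⋃ i, (U i : Set X) →
      b ≤ ∑ i, ν (OCSet.ofOpen (U i) (U i).2)) : b ≤ coverInf ν A :=
  le_iInf fun n => le_iInf₂ (h n)

theorem exists_cover_lt {ν : OCSet X → ℝ≥0∞} {A : Set X} {r : ℝ≥0∞} (h : coverInf ν A < r) :
    ∃ (n : ℕ) (U : Fin n → Opens X), A ⊆ ⋃ i, (U i : Set X) ∧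
      ∑ i, ν (OCSet.ofOpen (U i) (U i).2) < r := by
  simpa only [coverInf, iInf_lt_iff, exists_prop] using h

theorem coverInf_mono (ν : OCSet X → ℝ≥0∞) {A B : Set X} (h : A ⊆ B) :
    coverInf ν A ≤ coverInf ν B :=
  le_coverInf fun _ U hU => coverInf_le U (h.trans hU)

theorem coverInf_le_open (ν : OCSet X → ℝ≥0∞) {A : Set X} {U : OCSet X} (hU : IsOpen U.1)
    (h : A ⊆ U.1) : coverInf ν A ≤ ν U := by
  refine (coverInf_le (n := 1) (fun _ => ⟨U.1, hU⟩)
    (h.trans (subset_iUnion_of_subset 0 Subset.rfl))).trans ?_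
  rw [Fin.sum_univ_one]
  exact le_rfl

theorem coverInf_union_le (ν : OCSet X → ℝ≥0∞) (A B : Set X) :
    coverInf ν (A ∪ B) ≤ coverInf ν A + coverInf ν B := by
  refine ENNReal.le_of_forall_pos_le_add fun ε hε hfin => ?_
  rw [ENNReal.add_lt_top] at hfin
  have hε' : (ε / 2 : ℝ≥0∞) ≠ 0 := by simpa using hε.ne'
  obtain ⟨n, U, hU, hU'⟩ := exists_cover_lt (ENNReal.lt_add_right hfin.1.ne hε')
  obtain ⟨k, V, hV, hV'⟩ := exists_cover_lt (ENNReal.lt_add_right hfin.2.ne hε')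
  refine (coverInf_le (Fin.append U V) (union_subset (fun x hx => ?_) fun x hx => ?_)).trans ?_
  · obtain ⟨i, hi⟩ := mem_iUnion.1 (hU hx)
    exact mem_iUnion.2 ⟨Fin.castAdd k i, by simpa using hi⟩
  · obtain ⟨i, hi⟩ := mem_iUnion.1 (hV hx)
    exact mem_iUnion.2 ⟨Fin.natAdd n i, by simpa using hi⟩
  · rw [Fin.sum_univ_add]
    simp only [Fin.append_left, Fin.append_right]
    refine (add_le_add hU'.le hV'.le).trans_eq ?_
    rw [add_add_add_comm, ENNReal.add_halves]

/-- Source of maximality: no measure below `ν` can exceed the cover infimum. -/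
theorem measure_le_coverInf [MeasurableSpace X] {ν : OCSet X → ℝ≥0∞} {m : Measure X}
    (h : ∀ A : OCSet X, m A.1 ≤ ν A) (A : Set X) : m A ≤ coverInf ν A := by
  refine le_coverInf fun n U hU => ?_
  calc m A ≤ m (⋃ i, (U i : Set X)) := measure_mono hU
    _ ≤ ∑ i, m (U i) := measure_iUnion_fintype_le _ _
    _ ≤ _ := Finset.sum_le_sum fun i _ => h (OCSet.ofOpen (U i) (U i).2)

/-- Disjoint compact sets have disjoint open neighbourhoods. Cutting each member of a cover down to
both gives covers of `A` and `B`, and superadditivity on each member compares the sums. -/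
theorem IsDTM.add_coverInf_le [T2Space X] {ν : OCSet X → ℝ≥0∞} (h : IsDTM ν)
    (hfin : ν (OCSet.univ X) ≠ ∞) {A B : Set X} (hA : IsCompact A) (hB : IsCompact B)
    (hAB : Disjoint A B) : coverInf ν A + coverInf ν B ≤ coverInf ν (A ∪ B) := by
  obtain ⟨V, W, hV, hW, hAV, hBW, hVW⟩ := SeparatedNhds.of_isCompact_isCompact hA hB hAB
  refine le_coverInf fun n U hU => ?_
  have cover : ∀ {S T : Set X} (hT : IsOpen T), S ⊆ A ∪ B → S ⊆ T →
      S ⊆ ⋃ i, ((U i ⊓ ⟨T, hT⟩ : Opens X) : Set X) := by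
    intro S T hT hS hST x hx
    obtain ⟨i, hi⟩ := mem_iUnion.1 (hU (hS hx))
    exact mem_iUnion.2 ⟨i, hi, hST hx⟩
  refine (add_le_add (coverInf_le _ (cover hV subset_union_left hAV))
    (coverInf_le _ (cover hW subset_union_right hBW))).trans ?_
  rw [← Finset.sum_add_distrib]
  refine Finset.sum_le_sum fun i _ => h.add_le hfin (Or.inr (U i ⊓ ⟨V, hV⟩).2)
    (Or.inr (U i ⊓ ⟨W, hW⟩).2) ?_ ?_
  · exact hVW.mono inter_subset_right inter_subset_right
  · exact union_subset inter_subset_left inter_subset_left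

theorem measure_eq_zero_of_forall_isCompact [MeasurableSpace X] (m : Measure X) [m.Regular]
    (h : ∀ K, IsCompact K → m K = 0) : m = 0 := by
  rw [← Measure.measure_univ_eq_zero, isOpen_univ.measure_eq_iSup_isCompact]
  simp +contextual [h]

end Cover

/-! ### The largest Radon measure below a DTM, and the splitting. -/

namespace FinDTM

open TopologicalSpace

variable {X : Type*} [TopologicalSpace X]

theorem finM_subset_finTM [MeasurableSpace X] [BorelSpace X] : finM X ⊆ finTM X := by
  rintro μ ⟨m, -, -, h⟩
  refine isTM_iff_isDTM_and_add.2 ⟨μ.2.1, fun A B D _ _ _ hd hD => ?_⟩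
  rw [h, h, h, hD, measure_union hd B.measurableSet]

theorem coverInf_ne_top (ν : FinDTM X) (A : Set X) : coverInf ν.1 A ≠ ∞ :=
  ne_top_of_le_ne_top ν.2.2.ne (coverInf_le_open ν.1 isOpen_univ (subset_univ A))

section OfMeasure

variable [T2Space X] [MeasurableSpace X] [BorelSpace X]

/-- A compact set with two finite open covers is exhausted up to `δ` by disjoint compact sets
subordinate to both covers. -/
theorem exists_disjoint_compact_subcover (m : Measure X) [m.Regular] {K : Set X}
    (hK : IsCompact K) {n k : ℕ} (U : Fin n → Opens X) (V : Fin k → Opens X)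
    (hU : K ⊆ ⋃ i, (U i : Set X)) (hV : K ⊆ ⋃ j, (V j : Set X)) {δ : ℝ≥0∞} (hδ : δ ≠ 0) :
    ∃ C : Fin n × Fin k → OCSet X, (∀ p, IsCompact (C p).1) ∧
      (∀ p, (C p).1 ⊆ U p.1) ∧ (∀ p, (C p).1 ⊆ V p.2) ∧
      Pairwise (Function.onFun Disjoint fun p => (C p).1) ∧ m K ≤ ∑ p, m (C p).1 + δ := by
  have part : ∀ {l : ℕ} (W : Fin l → Opens X), K ⊆ ⋃ i, (W i : Set X) →
      ∃ A : Fin l → Set X, (∀ i, MeasurableSet (A i)) ∧ (∀ i, A i ⊆ W i) ∧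
        Pairwise (Function.onFun Disjoint A) ∧ K ⊆ ⋃ i, A i := by
    intro l W hW
    -- Each member loses the earlier ones; a point of `K` lies in the piece of least index among the
    -- members containing it.
    refine ⟨fun i => (W i : Set X) \ ⋃ j : {j // j < i}, (W j : Set X), fun i => ?_,
      fun i => sdiff_subset, ?_, fun x hx => ?_⟩
    · exact (W i).2.measurableSet.diff (MeasurableSet.iUnion fun j => (W j).2.measurableSet)
    · have hlt : ∀ i j : Fin l, i < j →
          Disjoint ((W i : Set X) \ ⋃ j : {j // j < i}, (W j : Set X))
            ((W j : Set X) \ ⋃ i : {i // i < j}, (W i : Set X)) := fun i j hij =>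
        disjoint_left.2 fun x hx hx' => hx'.2 (mem_iUnion.2 ⟨⟨i, hij⟩, hx.1⟩)
      intro i j hij
      rcases hij.lt_or_gt with h | h
      · exact hlt i j h
      · exact (hlt j i h).symm
    · obtain ⟨i, hi, hmin⟩ := WellFounded.has_min (wellFounded_lt (α := Fin l))
        {i | x ∈ W i} (mem_iUnion.1 (hW hx))
      refine mem_iUnion.2 ⟨i, hi, fun h => ?_⟩
      obtain ⟨j, hj⟩ := mem_iUnion.1 h
      exact hmin j hj j.2
  obtain ⟨A, hAm, hAU, hAd, hAK⟩ := part U hU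
  obtain ⟨B, hBm, hBV, hBd, hBK⟩ := part V hV
  have hm : ∀ p : Fin n × Fin k, MeasurableSet (K ∩ (A p.1 ∩ B p.2)) := fun p =>
    hK.measurableSet.inter ((hAm _).inter (hBm _))
  have hfin : ∀ p : Fin n × Fin k, m (K ∩ (A p.1 ∩ B p.2)) ≠ ∞ := fun p =>
    ne_top_of_le_ne_top hK.measure_ne_top (measure_mono inter_subset_left)
  -- Each of the `n * k` cells gets an equal share of the error. With no cells the share is `∞`,
  -- which is harmless since the sum is empty.
  have hδ' : δ / ((n * k : ℕ) : ℝ≥0∞) ≠ 0 := by simp [hδ, ENNReal.mul_eq_top]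
  choose C hCA hC hlt using fun p => (hm p).exists_isCompact_lt_add (hfin p) hδ'
  refine ⟨fun p => OCSet.ofCompact (C p) (hC p), hC, fun p => ?_, fun p => ?_, ?_, ?_⟩
  · exact (hCA p).trans fun x hx => hAU _ hx.2.1
  · exact (hCA p).trans fun x hx => hBV _ hx.2.2
  · rintro ⟨i, j⟩ ⟨i', j'⟩ hne
    refine Disjoint.mono (hCA _) (hCA _) ?_
    by_cases hi : i = i'
    · have hj : j ≠ j' := fun hj => hne (by rw [hi, hj])
      exact (hBd hj).mono (fun x hx => hx.2.2) fun x hx => hx.2.2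
    · exact (hAd hi).mono (fun x hx => hx.2.1) fun x hx => hx.2.1
  · calc m K ≤ m (⋃ p : Fin n × Fin k, K ∩ (A p.1 ∩ B p.2)) := by
          refine measure_mono fun x hx => ?_
          obtain ⟨i, hi⟩ := mem_iUnion.1 (hAK hx)
          obtain ⟨j, hj⟩ := mem_iUnion.1 (hBK hx)
          exact mem_iUnion.2 ⟨(i, j), hx, hi, hj⟩
      _ ≤ ∑ p : Fin n × Fin k, m (K ∩ (A p.1 ∩ B p.2)) := measure_iUnion_fintype_le _ _
      _ ≤ ∑ p : Fin n × Fin k, (m (C p) + δ / ((n * k : ℕ) : ℝ≥0∞)) :=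
          Finset.sum_le_sum fun p _ => (hlt p).le
      _ ≤ ∑ p, m (C p) + δ := by
          rw [Finset.sum_add_distrib]
          gcongr
          simpa using ENNReal.mul_div_le

/-- The restriction of a finite Radon measure to the open and closed sets. -/
noncomputable def ofMeasure (m : Measure X) [m.Regular] [IsFiniteMeasure m] : FinDTM X := by
  refine ⟨fun A => m A.1, IsDTM.of_forall_pos ?_ ?_ ?_ ?_ ?_, measure_lt_top m _⟩
  · exact fun A => measure_ne_top m _
  · exact fun F U _ _ h => measure_mono h
  · intro C K D _ hK hd hD
    simp only [hD]
    exact measure_union hd hK.measurableSet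
  · intro U hU ε hε
    obtain ⟨C, hCU, hC, hlt⟩ :=
      hU.measurableSet.exists_isCompact_lt_add (measure_ne_top m _) hε
    exact ⟨OCSet.ofCompact C hC, hC, hCU, hlt.le⟩
  · intro F hF ε hε
    obtain ⟨U, hFU, hU, hlt⟩ := F.1.exists_isOpen_lt_add (measure_ne_top m _) hε
    exact ⟨OCSet.ofOpen U hU, hU, hFU, hlt.le⟩

theorem mem_finM_iff {μ : FinDTM X} :
    μ ∈ finM X ↔ ∃ (m : Measure X) (_ : m.Regular) (_ : IsFiniteMeasure m), μ = ofMeasure m := by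
  constructor
  · rintro ⟨m, ho, hi, h⟩
    have hfin : IsFiniteMeasure m := ⟨(h (OCSet.univ X)).symm.trans_lt μ.2.2⟩
    exact ⟨m, ⟨hi⟩, hfin, Subtype.ext (funext h)⟩
  · rintro ⟨m, hm, -, rfl⟩
    exact ⟨m, inferInstance, Measure.Regular.innerRegular, fun A => rfl⟩

theorem ofMeasure_mem_finM (m : Measure X) [m.Regular] [IsFiniteMeasure m] :
    ofMeasure m ∈ finM X :=
  mem_finM_iff.2 ⟨m, inferInstance, inferInstance, rfl⟩

end OfMeasure

variable [T2Space X]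

/-- The content `K ↦ coverInf ν K`. -/
noncomputable def content (ν : FinDTM X) : Content X where
  toFun K := (coverInf ν.1 K).toNNReal
  mono' K L h := ENNReal.toNNReal_mono (ν.coverInf_ne_top _) (coverInf_mono _ h)
  sup_disjoint' K L hd _ _ := by
    rw [← ENNReal.toNNReal_add (ν.coverInf_ne_top _) (ν.coverInf_ne_top _), Compacts.coe_sup]
    congr 1
    exact le_antisymm (coverInf_union_le _ _ _)
      (ν.2.1.add_coverInf_le ν.2.2.ne K.isCompact L.isCompact hd)
  sup_le' K L := by
    rw [← ENNReal.toNNReal_add (ν.coverInf_ne_top _) (ν.coverInf_ne_top _), Compacts.coe_sup]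
    exact ENNReal.toNNReal_mono
      (ENNReal.add_ne_top.2 ⟨ν.coverInf_ne_top _, ν.coverInf_ne_top _⟩) (coverInf_union_le _ _ _)

theorem content_apply (ν : FinDTM X) (K : Compacts X) : ν.content K = coverInf ν.1 K :=
  ENNReal.coe_toNNReal (ν.coverInf_ne_top _)

variable [LocallyCompactSpace X]

/-- By local compactness, an open cover of `K` also covers a compact neighbourhood of `K`.
Regularity makes the induced measure agree with the content on compact sets. -/
theorem contentRegular (ν : FinDTM X) : ν.content.ContentRegular := by
  intro K
  refine le_antisymm (le_iInf₂ fun L hL => ν.content.mono _ _ (hL.trans interior_subset)) ?_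
  simp only [content_apply]
  refine le_coverInf fun n U hU => ?_
  obtain ⟨L, hL, hKL, hLU⟩ :=
    exists_compact_between K.isCompact (isOpen_iUnion fun i => (U i).2) hU
  exact (iInf₂_le (⟨L, hL⟩ : Compacts X) hKL).trans (coverInf_le U hLU)

variable [MeasurableSpace X] [BorelSpace X]

/-- The largest Radon measure below `ν`. -/
noncomputable def maxMeasure (ν : FinDTM X) : Measure X := ν.content.measure

instance (ν : FinDTM X) : ν.maxMeasure.Regular :=
  inferInstanceAs ν.content.measure.Regular

theorem maxMeasure_compact (ν : FinDTM X) {K : Set X} (hK : IsCompact K) :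
    ν.maxMeasure K = coverInf ν.1 K :=
  (ν.content.measure_eq_content_of_regular ν.contentRegular ⟨K, hK⟩).trans (ν.content_apply _)

theorem maxMeasure_le (ν : FinDTM X) (A : OCSet X) : ν.maxMeasure A.1 ≤ ν.1 A := by
  have hopen : ∀ U : OCSet X, IsOpen U.1 → ν.maxMeasure U.1 ≤ ν.1 U := by
    intro U hU
    rw [hU.measure_eq_iSup_isCompact]
    exact iSup₂_le fun K hKU => iSup_le fun hK =>
      (ν.maxMeasure_compact hK).trans_le (coverInf_le_open _ hU hKU)
  rcases A.2 with hA | hA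
  · exact hopen A hA
  · rw [ν.2.1.outer_regular A hA]
    refine le_sInf ?_
    rintro _ ⟨U, ⟨hU, hAU⟩, rfl⟩
    exact (measure_mono hAU).trans (hopen U hU)

instance (ν : FinDTM X) : IsFiniteMeasure ν.maxMeasure :=
  ⟨(ν.maxMeasure_le (OCSet.univ X)).trans_lt ν.2.2⟩

/-- Trades a condition on all measures for the existence of finite covers with small sums. -/
theorem mem_properDTM_iff_coverInf (ν : FinDTM X) :
    ν ∈ properDTM X ↔ ∀ K, IsCompact K → coverInf ν.1 K = 0 := by
  refine ⟨fun h K hK => ?_, fun h m hm hle => ?_⟩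
  · rw [← ν.maxMeasure_compact hK, h ν.maxMeasure inferInstance ν.maxMeasure_le]
    rfl
  · exact measure_eq_zero_of_forall_isCompact m fun K hK =>
      le_antisymm ((measure_le_coverInf hle K).trans_eq (h K hK)) zero_le

theorem smul_mem_properDTM (c : NNReal) {ν : FinDTM X} (hν : ν ∈ properDTM X) :
    c • ν ∈ properDTM X := by
  rw [mem_properDTM_iff_coverInf] at *
  intro K hK
  rw [← nonpos_iff_eq_zero]
  refine ENNReal.le_of_forall_pos_le_add fun ε hε _ => ?_
  have hε' : (ε / c : ℝ≥0∞) ≠ 0 := by simpa using hε.ne'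
  obtain ⟨n, U, hU, hU'⟩ := exists_cover_lt ((hν K hK).trans_lt (pos_iff_ne_zero.2 hε'))
  calc coverInf (c • ν).1 K ≤ ∑ i, c * ν.1 (OCSet.ofOpen (U i) (U i).2) := coverInf_le U hU
    _ ≤ c * (ε / c) := by rw [← Finset.mul_sum]; gcongr
    _ ≤ 0 + ε := by rw [zero_add]; exact ENNReal.mul_div_le

/-- The sum of proper finite deficient topological measures is proper. -/
theorem add_mem_properDTM {μ ν : FinDTM X} (hμ : μ ∈ properDTM X) (hν : ν ∈ properDTM X) :
    μ + ν ∈ properDTM X := by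
  rw [mem_properDTM_iff_coverInf] at hμ hν
  intro m hm hle
  refine measure_eq_zero_of_forall_isCompact m fun K hK => ?_
  rw [← nonpos_iff_eq_zero]
  refine ENNReal.le_of_forall_pos_le_add fun ε hε _ => ?_
  have hε2 : (ε / 2 : ℝ≥0∞) ≠ 0 := by simpa using hε.ne'
  have hε4 : (ε / 2 / 2 : ℝ≥0∞) ≠ 0 := by simpa using hε.ne'
  obtain ⟨n, U, hU, hU'⟩ :=
    exists_cover_lt ((hμ K hK).trans_lt (pos_iff_ne_zero.2 hε4))
  obtain ⟨k, V, hV, hV'⟩ :=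
    exists_cover_lt ((hν K hK).trans_lt (pos_iff_ne_zero.2 hε4))
  -- The sum of `μ` over all intersections `Uᵢ ∩ Vⱼ` need not be small, as these overlap. Disjoint
  -- compact sets `Cᵢⱼ ⊆ Uᵢ ∩ Vⱼ` avoid this: for fixed `i` their `μ`-values add up to at most
  -- `μ(Uᵢ)`, for fixed `j` their `ν`-values to at most `ν(Vⱼ)`.
  obtain ⟨C, hC, hCU, hCV, hd, hle'⟩ := exists_disjoint_compact_subcover m hK U V hU hV hε2
  have h1 : ∑ p, μ.1 (C p) ≤ ε / 2 / 2 := by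
    rw [Fintype.sum_prod_type]
    refine (Finset.sum_le_sum fun i _ => ?_).trans hU'.le
    exact μ.2.1.sum_compact_le μ.2.2.ne _ (fun j => C (i, j)) (fun j => hC _)
      (fun j j' hj => hd fun h => hj (Prod.ext_iff.1 h).2) (fun j _ => hCU (i, j))
  have h2 : ∑ p, ν.1 (C p) ≤ ε / 2 / 2 := by
    rw [Fintype.sum_prod_type_right]
    refine (Finset.sum_le_sum fun j _ => ?_).trans hV'.le
    exact ν.2.1.sum_compact_le ν.2.2.ne _ (fun i => C (i, j)) (fun i => hC _)
      (fun i i' hi => hd fun h => hi (Prod.ext_iff.1 h).1) (fun i _ => hCV (i, j))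
  calc m K ≤ ∑ p, m (C p).1 + ε / 2 := hle'
    _ ≤ ∑ p, (μ.1 (C p) + ν.1 (C p)) + ε / 2 := by
        gcongr with p
        exact hle (C p)
    _ ≤ ε / 2 / 2 + ε / 2 / 2 + ε / 2 := by
        rw [Finset.sum_add_distrib]
        gcongr
    _ = 0 + ε := by rw [ENNReal.add_halves, ENNReal.add_halves, zero_add]

/-- Every finite deficient topological measure is the sum of a Radon measure and a proper
deficient topological measure. -/
theorem exists_eq_add_proper (ν : FinDTM X) :
    ∃ μ ∈ finM X, ∃ ρ ∈ properDTM X, ν = μ + ρ := by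
  set m := ν.maxMeasure with hm_def
  have hmf : ∀ A : Set X, m A ≠ ∞ := fun A => measure_ne_top m A
  have hsub : ∀ A : OCSet X, (ν.1 A - m A.1) + m A.1 = ν.1 A := fun A =>
    tsub_add_cancel_of_le (ν.maxMeasure_le A)
  let ρ : OCSet X → ℝ≥0∞ := fun A => ν.1 A - m A.1
  have hρf : ∀ A, ρ A ≠ ∞ := fun A => ne_top_of_le_ne_top (ν.ne_top A) tsub_le_self
  have hρ : IsDTM ρ := by
    refine IsDTM.of_forall_pos hρf ?_ ?_ ?_ ?_
    -- Subtraction keeps monotonicity because `m(U \ F) ≤ ν(U \ F) ≤ ν(U) - ν(F)`.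
    · intro F U hF hU hFU
      let D : OCSet X := OCSet.ofOpen (U.1 \ F.1) (hU.sdiff hF)
      have h1 : ν.1 F + ν.1 D ≤ ν.1 U :=
        ν.2.1.closed_add_sdiff_le ν.2.2.ne hF hU hFU rfl
      have h2 : m F.1 + m D.1 = m U.1 := by
        exact (measure_union (μ := m) disjoint_sdiff_right D.measurableSet).symm.trans
          (congrArg m (union_sdiff_cancel hFU))
      refine (ENNReal.add_le_add_iff_right (hmf U.1)).1 ?_
      calc ρ F + m U.1 = (ρ F + m F.1) + m D.1 := by rw [← h2, add_assoc]
        _ ≤ ν.1 F + ν.1 D := add_le_add (hsub F).le (ν.maxMeasure_le D)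
        _ ≤ ρ U + m U.1 := h1.trans (hsub U).ge
    · intro C K D hC hK hd hD
      have h1 := ν.2.1.add_compact C K D hC hK hd hD
      have h2 : m D.1 = m C.1 + m K.1 := by rw [hD, measure_union hd hK.measurableSet]
      refine (ENNReal.add_left_inj (hmf D.1)).1 ?_
      calc ρ D + m D.1 = (ρ C + m C.1) + (ρ K + m K.1) := by
            rw [hsub D, h1, hsub C, hsub K]
        _ = ρ C + ρ K + m D.1 := by rw [h2, add_add_add_comm]
    · intro U hU ε hε
      obtain ⟨C, hC, hCU, hle⟩ := ν.2.1.exists_compact_le_add (Or.inr hU) (ν.ne_top U) hε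
      refine ⟨C, hC, hCU, (ENNReal.add_le_add_iff_right (hmf U.1)).1 ?_⟩
      calc ρ U + m U.1 ≤ ρ C + m C.1 + ε := by rw [hsub U, hsub C]; exact hle
        _ ≤ ρ C + m U.1 + ε := by gcongr
        _ = ρ C + ε + m U.1 := add_right_comm _ _ _
    · intro F hF ε hε
      obtain ⟨U, hU, hFU, hle⟩ := ν.2.1.exists_open_le_add hF (ν.ne_top F) hε
      refine ⟨U, hU, hFU, (ENNReal.add_le_add_iff_right (hmf U.1)).1 ?_⟩
      calc ρ U + m U.1 ≤ ρ F + m F.1 + ε := by rw [hsub U, hsub F]; exact hle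
        _ ≤ ρ F + m U.1 + ε := by gcongr
        _ = ρ F + ε + m U.1 := add_right_comm _ _ _
  refine ⟨ofMeasure m, ofMeasure_mem_finM m, ⟨ρ, hρ, (hρf _).lt_top⟩, ?_,
    Subtype.ext (funext fun A => ((add_comm _ _).trans (hsub A)).symm)⟩
  intro m' hm' hle
  refine measure_eq_zero_of_forall_isCompact m' fun K hK => ?_
  -- If `m' ≤ ρ`, then `m' + m ≤ ν`, so maximality of `m` on compact sets leaves no room for `m'`.
  have h1 : (m' + m) K ≤ coverInf ν.1 K := measure_le_coverInf (fun A => by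
    rw [← hsub A]
    exact add_le_add_left (hle A) _) K
  rw [← ν.maxMeasure_compact hK, Measure.add_apply, ← hm_def] at h1
  have h2 : m' K + m K ≤ 0 + m K := by simpa using h1
  exact nonpos_iff_eq_zero.1 ((ENNReal.add_le_add_iff_right (hmf K)).1 h2)

end FinDTM

/-! ### Quasi-integrals and the weak topology. -/

namespace FinDTM

variable {X : Type*} [TopologicalSpace X]

theorem intervalIntegrable_superlevel (μ : FinDTM X) (f : C₀(X, ℝ)) (a b : ℝ) :
    IntervalIntegrable (fun t => (μ.1 (superlevel f t)).toReal) volume a b := by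
  refine Antitone.intervalIntegrable fun s t hst => ?_
  refine ENNReal.toReal_mono (μ.ne_top _) (μ.2.1.mono ?_)
  exact preimage_mono (Ioi_subset_Ioi hst)

theorem continuous_quasiIntegral (f : C0Plus X) :
    Continuous fun μ : FinDTM X => quasiIntegral μ f :=
  (continuous_apply f).comp
    (continuous_induced_dom (f := fun (μ : FinDTM X) (f : C0Plus X) => quasiIntegral μ f))

theorem abs_apply_le_norm (f : C₀(X, ℝ)) (x : X) : |f x| ≤ ‖f‖ :=
  f.toBCF.norm_coe_le_norm x

section Cone

variable [T2Space X]

theorem quasiIntegral_add (μ ν : FinDTM X) (f : C0Plus X) :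
    quasiIntegral (μ + ν) f = quasiIntegral μ f + quasiIntegral ν f := by
  simp only [quasiIntegral, add_apply, ENNReal.toReal_add (μ.ne_top _) (ν.ne_top _)]
  exact intervalIntegral.integral_add (μ.intervalIntegrable_superlevel _ _ _)
    (ν.intervalIntegrable_superlevel _ _ _)

theorem quasiIntegral_smul (c : NNReal) (μ : FinDTM X) (f : C0Plus X) :
    quasiIntegral (c • μ) f = c * quasiIntegral μ f := by
  simp [quasiIntegral, smul_apply]

instance : ContinuousAdd (FinDTM X) where
  continuous_add := continuous_induced_rng.2 <| continuous_pi fun f => by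
    simp only [Function.comp_apply, quasiIntegral_add]
    exact ((continuous_quasiIntegral f).comp continuous_fst).add
      ((continuous_quasiIntegral f).comp continuous_snd)

instance : ContinuousSMul NNReal (FinDTM X) where
  continuous_smul := continuous_induced_rng.2 <| continuous_pi fun f => by
    simp only [Function.comp_apply, quasiIntegral_smul]
    exact (NNReal.continuous_coe.comp continuous_fst).mul
      ((continuous_quasiIntegral f).comp continuous_snd)

theorem add_mem_closure {P : Set (FinDTM X)} (hadd : ∀ μ ∈ P, ∀ ν ∈ P, μ + ν ∈ P)
    {μ ν : FinDTM X} (hμ : μ ∈ closure P) (hν : ν ∈ closure P) : μ + ν ∈ closure P :=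
  map_mem_closure₂ continuous_add hμ hν hadd

theorem smul_mem_closure {P : Set (FinDTM X)}
    (hsmul : ∀ c : NNReal, c ≠ 0 → ∀ μ ∈ P, c • μ ∈ P) (c : NNReal)
    {μ : FinDTM X} (hμ : μ ∈ closure P) : c • μ ∈ closure P := by
  have hpos : ∀ c : NNReal, c ≠ 0 → c • μ ∈ closure P := fun c hc =>
    map_mem_closure (continuous_const_smul c) hμ (hsmul c hc)
  -- `P` may omit zero, so the scalar `0` is reached as a limit of positive scalars.
  have hc : c ∈ closure (Ioi (0 : NNReal)) := by simp
  rw [← closure_closure (s := P)]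
  exact map_mem_closure (f := fun c : NNReal => c • μ) (by fun_prop) hc
    fun c hc => hpos c (ne_of_gt hc)

/-- `μ` is the limit of `μ + c • ν` as `c` tends to `0`. -/
theorem mem_closure_of_forall_add_smul_mem {P : Set (FinDTM X)} {μ ν : FinDTM X}
    (h : ∀ c : NNReal, c ≠ 0 → μ + c • ν ∈ P) : μ ∈ closure P := by
  have h0 : (0 : NNReal) ∈ closure (Ioi (0 : NNReal)) := by simp
  have h1 : μ + (0 : NNReal) • ν = μ :=
    Subtype.ext (funext fun A => by simp [add_apply, smul_apply])
  rw [← h1]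
  exact map_mem_closure (f := fun c : NNReal => μ + c • ν) (by fun_prop) h0
    fun c hc => h c (ne_of_gt hc)

theorem mem_finTM_of_add_right {μ ν : FinDTM X} (h : μ + ν ∈ finTM X) : ν ∈ finTM X := by
  refine mem_finTM_of_add_left (μ := ν) (ν := μ) ?_
  have : ν + μ = μ + ν := Subtype.ext (funext fun A => add_comm _ _)
  rwa [this]

end Cone

/-! ### Radon measures as limits of cones. -/

section Measures

variable [MeasurableSpace X] [BorelSpace X]

theorem integrable_zeroAtInfty (m : Measure X) [IsFiniteMeasure m] (f : C₀(X, ℝ)) :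
    Integrable f m :=
  Integrable.of_bound f.continuous.aestronglyMeasurable ‖f‖
    (Filter.Eventually.of_forall (abs_apply_le_norm f))

variable [T2Space X]

/-- The layer-cake formula; superlevel sets above `‖f‖` are empty, so stopping there loses nothing.
-/
theorem quasiIntegral_ofMeasure (m : Measure X) [m.Regular] [IsFiniteMeasure m]
    (f : C0Plus X) : quasiIntegral (ofMeasure m) f = ∫ x, f.1 x ∂m := by
  rw [(integrable_zeroAtInfty m f.1).integral_eq_integral_meas_lt
    (Filter.Eventually.of_forall f.2), quasiIntegral,
    intervalIntegral.integral_of_le (norm_nonneg _)]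
  refine (setIntegral_eq_of_subset_of_forall_sdiff_eq_zero measurableSet_Ioi
    Ioc_subset_Ioi_self fun t ht => ?_).symm
  have hlt : ‖f.1‖ < t := by
    by_contra! h
    exact ht.2 ⟨ht.1, h⟩
  have hempty : {x | t < f.1 x} = ∅ :=
    eq_empty_of_forall_notMem fun x hx =>
      (hlt.trans hx).not_ge ((le_abs_self _).trans (abs_apply_le_norm f.1 x))
  exact (congrArg m.real hempty).trans measureReal_empty

instance dirac_regular (x : X) : (Measure.dirac x).Regular where
  outerRegular A hA r hr := by
    by_cases hx : x ∈ A
    · refine ⟨Set.univ, subset_univ _, isOpen_univ, ?_⟩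
      rw [Measure.dirac_apply_of_mem (mem_univ x)]
      rwa [gt_iff_lt, Measure.dirac_apply_of_mem hx] at hr
    · refine ⟨{x}ᶜ, fun y hy => ?_, isOpen_compl_singleton, ?_⟩
      · rintro rfl
        exact hx hy
      · rw [Measure.dirac_apply' _ (measurableSet_singleton x).compl]
        simpa using pos_of_gt hr
  innerRegular U hU r hr := by
    by_cases hx : x ∈ U
    · refine ⟨{x}, singleton_subset_iff.2 hx, isCompact_singleton, ?_⟩
      rw [Measure.dirac_apply_of_mem hx] at hr
      rwa [Measure.dirac_apply_of_mem (mem_singleton x)]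
    · rw [Measure.dirac_apply' _ hU.measurableSet] at hr
      simp [hx] at hr

theorem ofMeasure_dirac_mem_pointMasses (x : X) :
    ofMeasure (Measure.dirac x) ∈ pointMasses X :=
  ⟨x, fun A => Measure.dirac_apply' x A.measurableSet⟩

/-- The closure of a convex cone that contains the point-masses in its closure contains all
finite Radon measures. -/
theorem finM_subset_closure_of_pointMasses {P : Set (FinDTM X)} (hne : P.Nonempty)
    (hadd : ∀ μ ∈ P, ∀ ν ∈ P, μ + ν ∈ P)
    (hsmul : ∀ c : NNReal, c ≠ 0 → ∀ μ ∈ P, c • μ ∈ P)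
    (hpt : pointMasses X ⊆ closure P) : finM X ⊆ closure P := by
  intro μ hμ
  obtain ⟨m, _, _, rfl⟩ := mem_finM_iff.1 hμ
  refine closure_induced.2 (mem_closure_iff.2 fun o ho hμo => ?_)
  obtain ⟨I, u, hu, huo⟩ := isOpen_pi_iff.1 ho _ hμo
  -- A basic weak neighbourhood sees only the test functions in `I`, so the problem moves to the
  -- finite-dimensional space `I → ℝ`.
  let R : FinDTM X → I → ℝ := fun μ i => quasiIntegral μ i.1
  have hR : Continuous R := continuous_pi fun i => continuous_quasiIntegral i.1
  have hRadd : ∀ μ ν, R (μ + ν) = R μ + R ν := fun μ ν =>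
    funext fun i => quasiIntegral_add μ ν i.1
  have hRsmul : ∀ (c : NNReal) μ, R (c • μ) = (c : ℝ) • R μ := fun c μ =>
    funext fun i => quasiIntegral_smul c μ i.1
  have hconv : Convex ℝ (R '' closure P) := by
    rintro _ ⟨μ, hμ, rfl⟩ _ ⟨ν, hν, rfl⟩ a b ha hb -
    lift a to NNReal using ha
    lift b to NNReal using hb
    rw [← hRsmul, ← hRsmul, ← hRadd]
    exact mem_image_of_mem R (add_mem_closure hadd (smul_mem_closure hsmul a hμ)
      (smul_mem_closure hsmul b hν))
  let F : X → I → ℝ := fun x i => i.1.1 x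
  have hFi : ∀ i, Integrable (F · i) m := fun i => integrable_zeroAtInfty m i.1.1
  have hRm : R (ofMeasure m) = ∫ x, F x ∂m := by
    funext i
    rw [eval_integral hFi]
    exact quasiIntegral_ofMeasure m i.1
  have hF : ∀ x, F x ∈ closure (R '' closure P) := fun x => by
    refine subset_closure ⟨_, hpt (ofMeasure_dirac_mem_pointMasses x), funext fun i => ?_⟩
    exact (quasiIntegral_ofMeasure _ i.1).trans (integral_dirac _ _)
  have havg : (⨍ x, F x ∂m) ∈ closure (R '' closure P) := by
    -- The average over the zero measure is `0` by default and is not a convex combination; it is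
    -- reached as `0 • p`, which is where `hne` enters.
    rcases eq_or_ne m 0 with rfl | hm
    · obtain ⟨p, hp⟩ := hne
      refine subset_closure ⟨_, smul_mem_closure hsmul 0 (subset_closure hp), ?_⟩
      rw [hRsmul, average_zero_measure]
      simp
    · have : NeZero m := ⟨hm⟩
      exact hconv.closure.average_mem isClosed_closure (Filter.Eventually.of_forall hF)
        (Integrable.of_eval hFi)
  have hmem : R (ofMeasure m) ∈ closure (R '' P) := by
    rw [← closure_image_closure hR, hRm, ← measure_smul_average]
    refine map_mem_closure (continuous_const_smul _) havg ?_
    rintro _ ⟨p, hp, rfl⟩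
    exact ⟨(m.real univ).toNNReal • p, smul_mem_closure hsmul _ hp, by
      rw [hRsmul, Real.coe_toNNReal _ measureReal_nonneg]⟩
  obtain ⟨_, hv, p, hp, rfl⟩ := mem_closure_iff.1 hmem
    (univ.pi fun i : I => u i.1) (isOpen_set_pi finite_univ fun i _ => (hu i.1 i.2).1)
    fun i _ => (hu i.1 i.2).2
  exact ⟨_, huo fun i hi => hv ⟨i, hi⟩ (mem_univ _), p, hp, rfl⟩

theorem zero_mem_finM : ofMeasure (0 : Measure X) ∈ finM X := ofMeasure_mem_finM 0

/-- If the finite Radon measures lie in the closure of `P`, then so do all sums of a finite Radon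
measure and a deficient topological measure by which `P` may be translated. -/
theorem add_mem_closure_of_finM_subset {P : Set (FinDTM X)} (hP : finM X ⊆ closure P)
    {μ ρ : FinDTM X} (hμ : μ ∈ finM X) (hρ : ∀ ν ∈ P, ν + ρ ∈ P) : μ + ρ ∈ closure P :=
  map_mem_closure (f := fun ν => ν + ρ) (by fun_prop) (hP hμ) hρ

theorem zero_mem_properTM : ofMeasure (0 : Measure X) ∈ properTM X := by
  refine ⟨fun m _ hle => ?_, finM_subset_finTM zero_mem_finM⟩
  have := hle (OCSet.univ X)
  exact Measure.measure_univ_eq_zero.1 (nonpos_iff_eq_zero.1 this)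

/-- If there is a finite deficient topological measure that is not a topological measure, then
such set functions are dense in the finite Radon measures. -/
theorem finM_subset_closure_compl_finTM {μ₀ : FinDTM X} (h : μ₀ ∉ finTM X) :
    finM X ⊆ closure (univ \ finTM X) := fun _ _ =>
  mem_closure_of_forall_add_smul_mem fun _ hc => ⟨mem_univ _, fun h' =>
    h ((smul_mem_finTM_iff hc).1 (mem_finTM_of_add_right h'))⟩

end Measures

/-! ### Passing density from measures to all DTMs. -/

section Density

variable [T2Space X] [LocallyCompactSpace X] [MeasurableSpace X] [BorelSpace X]

theorem properDTM_dense_of_finM_subset (h : finM X ⊆ closure (properDTM X)) (ν : FinDTM X) :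
    ν ∈ closure (properDTM X) := by
  obtain ⟨μ, hμ, ρ, hρ, rfl⟩ := ν.exists_eq_add_proper
  exact add_mem_closure_of_finM_subset h hμ fun ν hν => add_mem_properDTM hν hρ

theorem add_mem_properDTM_diff_finTM {μ ρ : FinDTM X} (hμ : μ ∈ properDTM X \ finTM X)
    (hρ : ρ ∈ properDTM X) : μ + ρ ∈ properDTM X \ finTM X :=
  ⟨add_mem_properDTM hμ.1 hρ, fun h => hμ.2 (mem_finTM_of_add_left h)⟩

theorem properDTM_diff_finTM_dense_of_finM_subset
    (h : finM X ⊆ closure (properDTM X \ finTM X)) (ν : FinDTM X) :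
    ν ∈ closure (properDTM X \ finTM X) := by
  obtain ⟨μ, hμ, ρ, hρ, rfl⟩ := ν.exists_eq_add_proper
  exact add_mem_closure_of_finM_subset h hμ fun ν hν => add_mem_properDTM_diff_finTM hν hρ

theorem finTM_subset_closure_of_finM_subset (h : finM X ⊆ closure (properTM X)) :
    finTM X ⊆ closure (properTM X) := by
  intro ν hν
  obtain ⟨μ, hμ, ρ, hρ, rfl⟩ := ν.exists_eq_add_proper
  exact add_mem_closure_of_finM_subset h hμ fun ν' hν' =>
    ⟨add_mem_properDTM hν'.1 hρ, add_mem_finTM hν'.2 (mem_finTM_of_add_right hν)⟩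

theorem finM_subset_closure_properDTM_diff_finTM [Nonempty X]
    (h : pointMasses X ⊆ closure ((properDTM X ∩ simpleDTM X) \ finTM X)) :
    finM X ⊆ closure (properDTM X \ finTM X) := by
  have hsub : (properDTM X ∩ simpleDTM X) \ finTM X ⊆ properDTM X \ finTM X :=
    fun μ hμ => ⟨hμ.1.1, hμ.2⟩
  have hpt := h.trans (closure_mono hsub)
  refine finM_subset_closure_of_pointMasses ?_
    (fun μ hμ ν hν => add_mem_properDTM_diff_finTM hμ hν.1)
    (fun c hc μ hμ => ⟨smul_mem_properDTM c hμ.1, fun h => hμ.2 ((smul_mem_finTM_iff hc).1 h)⟩)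
    hpt
  -- A point-mass in the closure shows that the cone is nonempty. For empty `X` the hypothesis is
  -- vacuous while the only DTM is `0`, a TM.
  exact closure_nonempty_iff.1 ⟨_, hpt (ofMeasure_dirac_mem_pointMasses (Classical.arbitrary X))⟩

theorem finM_subset_closure_properTM
    (h : pointMasses X ⊆ closure (properTM X ∩ simpleDTM X)) :
    finM X ⊆ closure (properTM X) :=
  finM_subset_closure_of_pointMasses ⟨_, zero_mem_properTM⟩
    (fun _ hμ _ hν => ⟨add_mem_properDTM hμ.1 hν.1, add_mem_finTM hμ.2 hν.2⟩)
    (fun c _ _ hμ => ⟨smul_mem_properDTM c hμ.1, smul_mem_finTM c hμ.2⟩)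
    (h.trans (closure_mono inter_subset_left))

end Density

end FinDTM

theorem mainTheorem8 (X : Type*) [TopologicalSpace X] [T2Space X] [LocallyCompactSpace X]
    [MeasurableSpace X] [BorelSpace X] :
    -- deficient topological measures
    ((Nonempty X → DenseIn ((properDTM X ∩ simpleDTM X) \ finTM X) (pointMasses X) →
        DenseIn (properDTM X \ finTM X) (finM X)) ∧
      (DenseIn (properDTM X \ finTM X) (finM X) ↔
        (univ \ finTM X).Nonempty ∧ DenseIn (properDTM X \ finTM X) (univ \ finTM X)) ∧
      ((univ \ finTM X).Nonempty ∧ DenseIn (properDTM X \ finTM X) (univ \ finTM X) →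
        DenseIn (properDTM X) (univ : Set (FinDTM X))) ∧
      (DenseIn (properDTM X) (univ : Set (FinDTM X)) ↔ DenseIn (properDTM X) (finM X))) ∧
    -- topological measures
    ((DenseIn (properTM X ∩ simpleDTM X) (pointMasses X) → DenseIn (properTM X) (finM X)) ∧
      (DenseIn (properTM X) (finM X) ↔ DenseIn (properTM X) (finTM X)) ∧
      (DenseIn (properTM X) (finTM X) →
        DenseIn (properDTM X) (univ : Set (FinDTM X)))) := by
  have hCB : (univ \ finTM X).Nonempty ∧ DenseIn (properDTM X \ finTM X) (univ \ finTM X) →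
      DenseIn (properDTM X \ finTM X) (finM X) := by
    rintro ⟨⟨μ₀, -, hμ₀⟩, h⟩
    exact (FinDTM.finM_subset_closure_compl_finTM hμ₀).trans (closure_minimal h isClosed_closure)
  refine ⟨⟨fun _ h => FinDTM.finM_subset_closure_properDTM_diff_finTM h, ⟨fun h => ⟨?_, ?_⟩, hCB⟩,
    fun h ν _ => ?_, fun h => (subset_univ _).trans h,
    fun h ν _ => FinDTM.properDTM_dense_of_finM_subset h ν⟩,
    FinDTM.finM_subset_closure_properTM, ⟨FinDTM.finTM_subset_closure_of_finM_subset,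
      fun h => FinDTM.finM_subset_finTM.trans h⟩, fun h ν _ => ?_⟩
  -- The zero measure lies in the closure, so the set itself cannot be empty.
  · obtain ⟨μ, hμ⟩ := closure_nonempty_iff.1 ⟨_, h FinDTM.zero_mem_finM⟩
    exact ⟨μ, mem_univ _, hμ.2⟩
  · exact fun ν _ => FinDTM.properDTM_diff_finTM_dense_of_finM_subset h ν
  · exact closure_mono sdiff_subset (FinDTM.properDTM_diff_finTM_dense_of_finM_subset (hCB h) ν)
  · exact FinDTM.properDTM_dense_of_finM_subset
      ((FinDTM.finM_subset_finTM.trans h).trans (closure_mono inter_subset_left)) ν
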